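/- For $n\ge 0$ and non-negative integers $a_1,\dots,a_n$ let the Gaussian bracket be defined by $G[\,]=1$, $G[a_1]=a_1$ and $G[a_1,\dots,a_n]=a_n\,G[a_1,\dots,a_{n-1}]+G[a_1,\dots,a_{n-2}]$ for $n\ge 2$. Let $R(a_1,\dots,a_n)$ be the alternating diagram (Conway normal form) of the rational knot or link with conways $a_1,\dots,a_n$: four vertical strands start from two minima placed side by side; then, going upwards, for $j=1,\dots,n$ the two middle strands ($j$ odd) or the two left strands ($j$ even) are twisted around each other with $a_j$ crossings (the $j$-th conway), the handedness of the twists alternating with $j$; finally the four strands are closed by two maxima, side by side if $n$ is odd, nested if $n$ is even. A conway equal to $0$ consists of two untwisted strands. The Conway's function (C-function) of a family of links with $n$ conways is the function of the conways $a_1,\dots,a_n\in\mathbb N\cup\{0\}$ whose value is Conway's number (the determinant) $|\Delta(-1)|$ of the corresponding member of the family, where $\Delta$ is the one-variable Alexander polynomial of the link, for any orientation. Theorem. For $n=2,3,4,5$ the C-function of the family $R(a_1,\dots,a_n)$ of rational knots and links is the Gaussian bracket: the determinant of $R(a_1,\dots,a_n)$ equals $G[a_1,\dots,a_n]$ for all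 integers $a_1,\dots,a_n\ge 0$. -/

import Mathlib

/-!
Link diagrams in the plane, cut by horizontal lines into elementary slices, their Alexander
matrices, and the alternating diagrams of the rational knots and links with given conways.
-/

open scoped LaurentPolynomial

/-- `LinkDiagram m` is the type of the parts, below a horizontal line that meets the diagram in `m`
points, of link diagrams in the plane in general position with respect to the height function. The
points on the line (strands) are numbered `0, …, m - 1` from left to right. Such a part is built
from bottom to top out of local minima, local maxima and crossings. A link diagram is an element of
`LinkDiagram 0`. -/
inductive LinkDiagram : ℕ → Type
  /-- the empty diagram -/
  | empty : LinkDiagram 0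
  /-- a local minimum is added, whose two legs become the strands `i` and `i + 1` -/
  | cup {m : ℕ} (D : LinkDiagram m) (i : Fin (m + 1)) : LinkDiagram (m + 2)
  /-- the strands `i` and `i + 1` are joined by a local maximum -/
  | cap {m : ℕ} (D : LinkDiagram (m + 2)) (i : Fin (m + 1)) : LinkDiagram m
  /-- the strands `i` and `i + 1` cross once; the one that goes from the lower left to the upper
  right passes over the other if `s = true`, and under it if `s = false` -/
  | cross {m : ℕ} (D : LinkDiagram (m + 2)) (i : Fin (m + 1)) (s : Bool) : LinkDiagram (m + 2)

namespace LinkDiagram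

/-- The number of arcs met so far. A new arc begins at each local minimum (with two legs), and at
each crossing, where the upper part of the strand that passes under is a new arc. -/
def arcs : {m : ℕ} → LinkDiagram m → ℕ
  | _, empty => 0
  | _, cup D _ => D.arcs + 1
  | _, cap D _ => D.arcs
  | _, cross D _ _ => D.arcs + 1

/-- The number of the arc (arcs are numbered from `0` in the order of their appearance) to which the
strand in position `j < m` on the top line belongs. Values at `j ≥ m` are meaningless. -/
def label : {m : ℕ} → LinkDiagram m → ℕ → ℕ
  | _, empty, _ => 0
  | _, cup D i, j =>
      if j < i then D.label j
      else if j = i ∨ j = i + 1 then D.arcs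
      else D.label (j - 2)
  | _, cap D i, j => if j < i then D.label j else D.label (j + 2)
  | _, cross D i s, j =>
      if j = i then (if s then D.arcs else D.label (i + 1))
      else if j = i + 1 then (if s then D.label i else D.arcs)
      else D.label j

/-- Let the arcs be directed such that the left leg of a local minimum with arc number `k` is
directed upwards if and only if `o k = true`, the right leg being directed the other way, and such
that directions are carried along through the crossings. Then `D.up o j` tells whether the strand in
position `j < m` on the top line is directed upwards. Values at `j ≥ m` are meaningless. -/
def up (o : ℕ → Bool) : {m : ℕ} → LinkDiagram m → ℕ → Bool
  | _, empty, _ => true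
  | _, cup D i, j =>
      if j < i then D.up o j
      else if j = i then o D.arcs
      else if j = i + 1 then !(o D.arcs)
      else D.up o (j - 2)
  | _, cap D i, j => if j < i then D.up o j else D.up o (j + 2)
  | _, cross D i _, j =>
      if j = i then D.up o (i + 1)
      else if j = i + 1 then D.up o i
      else D.up o j

/-- The directions given by `o` fit together at each local maximum, so that they orient the link. -/
def IsOrientation (o : ℕ → Bool) : {m : ℕ} → LinkDiagram m → Prop
  | _, empty => True
  | _, cup D _ => D.IsOrientation o
  | _, cap D i => D.IsOrientation o ∧ D.up o i ≠ D.up o (i + 1)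
  | _, cross D _ _ => D.IsOrientation o

/-- The rows of the Alexander matrix, i.e. the Fox derivatives of the Wirtinger relations, of an
oriented diagram: a crossing with over-arc `x`, and under-arcs `l` on the left and `r` on the
right of the directed over-arc, gives `(1 - t) x + t l - r`; a local maximum that joins the arcs `p`
and `q` gives `p - q`. -/
def relations {R : Type*} [CommRing R] (t : R) (o : ℕ → Bool) :
    {m : ℕ} → LinkDiagram m → List (ℕ → R)
  | _, empty => []
  | _, cup D _ => D.relations t o
  | _, cap D i =>
      (Pi.single (D.label i) 1 - Pi.single (D.label (i + 1)) 1) :: D.relations t o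
  | _, cross D i s =>
      -- the position of the over-strand below the crossing
      let ov : ℕ := if s then i else i + 1
      -- the under-arcs on the left and on the right of the over-strand, seen upwards
      let lu : ℕ := if s then D.arcs else D.label i
      let ru : ℕ := if s then D.label (i + 1) else D.arcs
      let l : ℕ := if D.up o ov then lu else ru
      let r : ℕ := if D.up o ov then ru else lu
      (Pi.single (D.label ov) (1 - t) + Pi.single l t - Pi.single r 1) :: D.relations t o

/-- The Alexander matrix in the variable `t` of an oriented link diagram. -/
def alexanderMatrix {R : Type*} [CommRing R] (t : R) (o : ℕ → Bool) (D : LinkDiagram 0) :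
    Matrix (Fin (D.relations t o).length) (Fin D.arcs) R :=
  Matrix.of fun i j => (D.relations t o).get i j

/-- `Δ` is the (one-variable) Alexander polynomial, which is defined up to units `±T ^ k`, of the
link diagram `D` with the orientation `o`: up to a unit, it is a minor of the Alexander matrix
whose order is one less than the number of arcs. -/
def IsAlexanderPolynomial (D : LinkDiagram 0) (o : ℕ → Bool) (Δ : ℤ[T;T⁻¹]) : Prop :=
  ∃ (k : ℕ) (f : Fin k → Fin (D.relations (LaurentPolynomial.T 1 : ℤ[T;T⁻¹]) o).length)
    (g : Fin k → Fin D.arcs), k + 1 = D.arcs ∧ Function.Injective f ∧ Function.Injective g ∧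
    Associated Δ ((D.alexanderMatrix (LaurentPolynomial.T 1 : ℤ[T;T⁻¹]) o).submatrix f g).det

/-- The value of a Laurent polynomial with integer coefficients at `-1`. -/
noncomputable def evalNegOne (Δ : ℤ[T;T⁻¹]) : ℤ :=
  LaurentPolynomial.eval₂ (RingHom.id ℤ) (-1 : ℤˣ) Δ

/-- `c` is Conway's number (the determinant) of the link with diagram `D`: the absolute value of the
Alexander polynomial at `-1`, for any orientation. -/
def IsConwayNumber (D : LinkDiagram 0) (c : ℕ) : Prop :=
  (∃ (o : ℕ → Bool) (Δ : ℤ[T;T⁻¹]), D.IsOrientation o ∧ D.IsAlexanderPolynomial o Δ) ∧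
  ∀ (o : ℕ → Bool) (Δ : ℤ[T;T⁻¹]), D.IsOrientation o → D.IsAlexanderPolynomial o Δ →
    (evalNegOne Δ).natAbs = c

/-- `C` is the Conway's function of the family `F` of links with `n` conways: its value at the
conways of a member of the family is Conway's number of this member. -/
def IsConwayFunction {n : ℕ} (F : (Fin n → ℕ) → LinkDiagram 0) (C : (Fin n → ℕ) → ℕ) : Prop :=
  ∀ a : Fin n → ℕ, IsConwayNumber (F a) (C a)

/-- A conway: the strands `i` and `i + 1` are twisted `k` times with handedness `s`. -/
def twist {m : ℕ} (D : LinkDiagram (m + 2)) (i : Fin (m + 1)) (s : Bool) : ℕ → LinkDiagram (m + 2)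
  | 0 => D
  | k + 1 => (D.twist i s k).cross i s

/-- Four strands that start as two minima side by side, followed by the conways
`a 0, a 1, a 2, …`, alternately of the two middle strands and of the two left strands, with
alternating handedness. -/
def rationalTangle : (n : ℕ) → (Fin n → ℕ) → LinkDiagram 4
  | 0, _ => cup (m := 2) (cup (m := 0) empty 0) 2
  | n + 1, a =>
      twist (m := 2) (rationalTangle n fun i => a i.castSucc) (if Even n then 1 else 0)
        (decide (Even n)) (a (Fin.last n))

/-- The alternating diagram (Conway normal form) of the rational knot or link with conways
`a 0, …, a (n - 1)`. The four strands above the last conway are closed such that a last conway of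
several crossings cannot be untwisted: by two maxima side by side if the last conway is one of the
two middle strands (`n` odd), and by two nested maxima otherwise (`n` even). -/
def rational (n : ℕ) (a : Fin n → ℕ) : LinkDiagram 0 :=
  cap (m := 0) (cap (m := 2) (rationalTangle n a) (if Even n then 1 else 0)) 0

end LinkDiagram

/-- The Gaussian bracket `G[a_1, …, a_n]`. -/
def gaussianBracket : (n : ℕ) → (Fin n → ℕ) → ℕ
  | 0, _ => 1
  | 1, a => a 0
  | n + 2, a =>
      a (Fin.last (n + 1)) * gaussianBracket (n + 1) (fun i => a i.castSucc)
        + gaussianBracket n (fun i => a i.castSucc.castSucc)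

/-! At `t = -1` a crossing with over-arc `x` and under-arcs `l`, `r` gives `2x - l - r` for either
orientation: the Fox coloring relation. The diagram has as many relations as arcs, row sums vanish,
and some combination of the rows with signs `±1` is zero, so all minors of order one less agree up
to sign and one of them suffices (`abs_det_submatrix_eq_of_sum_eq_zero`). Delete the relation of the
outer maximum and the column of arc `0`. Color the two minima `0` and `1` and propagate upwards
through the crossings. This coloring solves every remaining relation except that of the first
maximum, and the crossing relations are triangular with entries `-1`; hence the minor is, up to
sign, the color difference at that maximum (`IsTwoCupBraid.abs_det_alexanderMatrix`). A twist
preserves the color difference of its two strands and adds a multiple of it to the neighbouring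
difference. This is the recursion of the Gaussian bracket (`color_rationalTangle`). -/

theorem Function.Injective.exists_eq_succAbove_comp_perm {k : ℕ} {f : Fin k → Fin (k + 1)}
    (hf : Function.Injective f) :
    ∃ (i : Fin (k + 1)) (σ : Equiv.Perm (Fin k)), f = i.succAbove ∘ σ := by
  have hns : ¬ Function.Surjective f := fun h => by
    have := Fintype.card_le_of_surjective f h
    simp at this
  obtain ⟨i, hi⟩ := not_forall.mp hns
  have hne : ∀ x, ∃ y, i.succAbove y = f x := fun x =>
    Fin.exists_succAbove_eq fun h => hi ⟨x, h⟩
  choose σ hσ using hne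
  have hinj : Function.Injective σ := fun x y h => hf (by rw [← hσ, ← hσ, h])
  exact ⟨i, Equiv.ofBijective σ (Finite.injective_iff_bijective.mp hinj),
    funext fun x => (hσ x).symm⟩

namespace Matrix

/-- If the rows of a square integer matrix satisfy a relation with coefficients `±1` and all its row
sums vanish, then all the minors of maximal proper order agree up to sign. -/
theorem abs_det_submatrix_eq_of_sum_eq_zero {k : ℕ} (M : Matrix (Fin (k + 1)) (Fin (k + 1)) ℤ)
    (ε : Fin (k + 1) → ℤˣ) (hrow : ∑ i, (ε i : ℤ) • M i = 0) (hcol : ∀ i, ∑ j, M i j = 0)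
    {f g : Fin k → Fin (k + 1)} (hf : Function.Injective f) (hg : Function.Injective g) :
    |(M.submatrix f g).det| = |(M.submatrix Fin.succ Fin.succ).det| := by
  obtain ⟨i, σ, rfl⟩ := hf.exists_eq_succAbove_comp_perm
  obtain ⟨j, τ, rfl⟩ := hg.exists_eq_succAbove_comp_perm
  -- Scaling the rows by `ε` turns the signed relation into a vanishing plain sum of rows and
  -- changes minors only by a sign.
  have hscale : ∀ (i : Fin (k + 1)),
      |((of fun a b => (ε a : ℤ) * M a (j.succAbove b) :
        Matrix (Fin (k + 1)) (Fin k) ℤ).submatrix i.succAbove id).det|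
        = |(M.submatrix i.succAbove j.succAbove).det| := by
    intro i
    have := det_mul_column (fun a => (ε (i.succAbove a) : ℤ))
      (M.submatrix i.succAbove j.succAbove)
    have h1 : |∏ a, (ε (i.succAbove a) : ℤ)| = 1 := by
      rw [Finset.abs_prod]
      exact Finset.prod_eq_one fun a _ => Int.isUnit_iff_abs_eq.mp (ε _).isUnit
    rw [show ((of fun a b => (ε a : ℤ) * M a (j.succAbove b) :
        Matrix (Fin (k + 1)) (Fin k) ℤ).submatrix i.succAbove id)
        = of fun a b => (ε (i.succAbove a) : ℤ) * M.submatrix i.succAbove j.succAbove a b from rfl,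
      this, abs_mul, h1, one_mul]
  calc |(M.submatrix (i.succAbove ∘ σ) (j.succAbove ∘ τ)).det|
      = |(M.submatrix i.succAbove j.succAbove).det| :=
        abs_det_submatrix_equiv_equiv σ τ (M.submatrix i.succAbove j.succAbove)
    _ = |(M.submatrix (Fin.succAbove 0) j.succAbove).det| := by
        rw [← hscale, ← hscale, submatrix_succAbove_det_eq_negOnePow_submatrix_succAbove_det _ _ i 0,
          Units.smul_def, abs_zsmul, Int.abs_negOnePow, one_smul]
        ext b
        refine (Finset.sum_apply b Finset.univ _).trans ?_
        simpa using congrFun hrow (j.succAbove b)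
    _ = |(M.submatrix (Fin.succAbove 0) (Fin.succAbove 0)).det| := by
        have := submatrix_succAbove_det_eq_negOnePow_submatrix_succAbove_det'
          (M.submatrix (Fin.succAbove 0) id) (fun a => hcol _) j 0
        simp only [submatrix_submatrix, Function.comp_id, Function.id_comp] at this
        rw [this, Units.smul_def, abs_zsmul, Int.abs_negOnePow, one_smul]
    _ = |(M.submatrix Fin.succ Fin.succ).det| := by
        simp only [Fin.succAbove_zero]

/-- The determinant of a matrix with a vector that is annihilated by all rows but the first, in case
that the lower right part becomes triangular with diagonal entries `-1` by reversing its rows. -/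
theorem abs_det_of_mulVec_eq_zero {c : ℕ} (B : Matrix (Fin (c + 1)) (Fin (c + 1)) ℤ)
    (x : Fin (c + 1) → ℤ) (hx : x 0 = 1) (hB : ∀ i : Fin c, ∑ j, B i.succ j * x j = 0)
    (hdiag : ∀ i : Fin c, B i.rev.succ i.succ = -1)
    (htri : ∀ i j : Fin c, i < j → B i.rev.succ j.succ = 0) :
    |B.det| = |∑ j, B 0 j * x j| := by
  have hlow : |(B.submatrix Fin.succ Fin.succ).det| = 1 := by
    rw [← abs_det_submatrix_equiv_equiv Fin.revPerm (Equiv.refl _), det_of_isLowerTriangular]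
    · simp [hdiag]
    · intro i j hij
      exact htri i j hij
  -- Since `x 0 = 1`, replacing column `0` by `B x` keeps the determinant; that column is then zero
  -- below its first entry.
  have h := det_updateCol_sum B 0 x
  rw [hx, one_smul] at h
  rw [← h, det_succ_column_zero, Fin.sum_univ_succ]
  have h0 : ∀ i : Fin c, ∑ j, x j • B i.succ j = 0 := fun i => by
    rw [← hB i]; simp [mul_comm]
  simp only [updateCol_self, h0]
  have hsub : ((B.updateCol 0 fun k => ∑ i, x i • B k i).submatrix (Fin.succAbove 0) Fin.succ)
      = B.submatrix Fin.succ Fin.succ := by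
    ext i j
    simp
  rw [hsub]
  simp [abs_mul, hlow, mul_comm]

end Matrix

namespace LinkDiagram

/-! ### Relations at `t = -1`: support and row sums -/

theorem label_lt_arcs : ∀ {m : ℕ} (D : LinkDiagram m) {j : ℕ}, j < m → D.label j < D.arcs
  | _, empty, j, hj => by omega
  | _, cup D i, j, hj => by
      have h1 := fun k => label_lt_arcs D (j := k)
      have := h1 j; have := h1 (j - 2)
      have := i.2
      simp only [label, arcs]
      split_ifs <;> omega
  | _, cap D i, j, hj => by
      simp only [label, arcs]
      split_ifs <;> exact label_lt_arcs D (by omega)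
  | _, cross D i s, j, hj => by
      have h1 := fun k => label_lt_arcs D (j := k)
      have := h1 j; have := h1 i; have := h1 (i + 1)
      have := i.2
      simp only [label, arcs]
      split_ifs <;> omega

/-- At `t = -1`, the relation of a crossing does not depend on the orientation. -/
theorem relations_neg_one_cross (o : ℕ → Bool) {m : ℕ} (D : LinkDiagram (m + 2)) (i : Fin (m + 1))
    (s : Bool) : (D.cross i s).relations (-1 : ℤ) o =
      (Pi.single (D.label (if s then i else i + 1)) 2 - Pi.single (D.label (if s then i + 1 else i)) 1
        - Pi.single D.arcs 1) :: D.relations (-1 : ℤ) o := by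
  rw [relations]
  congr 1
  ext j
  cases s <;> simp only [Bool.false_eq_true, if_true, if_false] <;> split_ifs <;>
    simp only [Pi.add_apply, Pi.sub_apply, Pi.single_apply] <;> split_ifs <;> norm_num

theorem relations_apply_eq_zero (o : ℕ → Bool) : ∀ {m : ℕ} (D : LinkDiagram m),
    ∀ r ∈ D.relations (-1 : ℤ) o, ∀ j, D.arcs ≤ j → r j = 0
  | _, empty, r, hr, j, hj => by simp [relations] at hr
  | _, cup D i, r, hr, j, hj => relations_apply_eq_zero o D r hr j (by simp only [arcs] at hj; omega)
  | _, cap D i, r, hr, j, hj => by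
      simp only [arcs] at hj
      rw [relations, List.mem_cons] at hr
      rcases hr with rfl | hr
      · have := D.label_lt_arcs (j := i) (by omega)
        have := D.label_lt_arcs (j := i + 1) (by omega)
        simp [show j ≠ D.label i by omega, show j ≠ D.label (i + 1) by omega]
      · exact relations_apply_eq_zero o D r hr j hj
  | _, cross D i s, r, hr, j, hj => by
      simp only [arcs] at hj
      rw [relations_neg_one_cross, List.mem_cons] at hr
      rcases hr with rfl | hr
      · have := D.label_lt_arcs (j := i) (by omega)
        have := D.label_lt_arcs (j := i + 1) (by omega)
        cases s <;> simp [show j ≠ D.label i by omega,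
          show j ≠ D.label (i + 1) by omega, show j ≠ D.arcs by omega]
      · exact relations_apply_eq_zero o D r hr j (by omega)

theorem sum_single_mul {N p : ℕ} (hp : p < N) (c : ℤ) (x : ℕ → ℤ) :
    ∑ j ∈ Finset.range N, (Pi.single p c : ℕ → ℤ) j * x j = c * x p := by
  simp [Pi.single_apply, hp]

theorem sum_relation_eq_zero (o : ℕ → Bool) {N : ℕ} : ∀ {m : ℕ} (D : LinkDiagram m), D.arcs ≤ N →
    ∀ r ∈ D.relations (-1 : ℤ) o, ∑ j ∈ Finset.range N, r j = 0
  | _, empty, hN, r, hr => by simp [relations] at hr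
  | _, cup D i, hN, r, hr => sum_relation_eq_zero o D (by simp only [arcs] at hN; omega) r hr
  | _, cap D i, hN, r, hr => by
      simp only [arcs] at hN
      rw [relations, List.mem_cons] at hr
      rcases hr with rfl | hr
      · have := D.label_lt_arcs (j := i) (by omega)
        have := D.label_lt_arcs (j := i + 1) (by omega)
        simp [Finset.sum_sub_distrib, Pi.single_apply, show D.label i < N by omega,
          show D.label (i + 1) < N by omega]
      · exact sum_relation_eq_zero o D hN r hr
  | _, cross D i s, hN, r, hr => by
      simp only [arcs] at hN
      rw [relations_neg_one_cross, List.mem_cons] at hr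
      rcases hr with rfl | hr
      · have := D.label_lt_arcs (j := i) (by omega)
        have := D.label_lt_arcs (j := i + 1) (by omega)
        cases s <;> simp [Finset.sum_sub_distrib, Pi.single_apply, show D.label i < N by omega,
          show D.label (i + 1) < N by omega, show D.arcs < N by omega]
      · exact sum_relation_eq_zero o D (by omega) r hr

/-! ### The signed relation between the rows -/

/-- The alternating sum of the arcs on the top line. -/
def alternatingSum {m : ℕ} (D : LinkDiagram m) : ℕ → ℤ :=
  ∑ j ∈ Finset.range m, (-1 : ℤ) ^ j • Pi.single (D.label j) 1

theorem sum_range_add_two {A : Type*} [AddCommMonoid A] (f : ℕ → A) {m i : ℕ} (hi : i ≤ m) :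
    ∑ j ∈ Finset.range (m + 2), f j = ∑ j ∈ Finset.range i, f j + f i + f (i + 1)
      + ∑ j ∈ Finset.range (m - i), f (i + 2 + j) := by
  rw [← Finset.sum_range_succ, ← Finset.sum_range_succ, ← Finset.sum_range_add]
  congr 2; omega

theorem sum_range_split {A : Type*} [AddCommMonoid A] (f : ℕ → A) {m i : ℕ} (hi : i ≤ m) :
    ∑ j ∈ Finset.range m, f j = ∑ j ∈ Finset.range i, f j
      + ∑ j ∈ Finset.range (m - i), f (i + j) := by
  rw [← Finset.sum_range_add]
  congr 2; omega

/-- The two new legs carry the same arc with opposite signs, and the strands to their right move by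
two places, which keeps their signs. -/
theorem alternatingSum_cup {m : ℕ} (D : LinkDiagram m) (i : Fin (m + 1)) :
    (D.cup i).alternatingSum = D.alternatingSum := by
  have hi : (i : ℕ) ≤ m := by omega
  rw [alternatingSum, alternatingSum, sum_range_add_two _ hi, sum_range_split _ hi]
  have h1 : ∀ j ∈ Finset.range (i : ℕ), (-1 : ℤ) ^ j • (Pi.single ((D.cup i).label j) 1 : ℕ → ℤ)
      = (-1 : ℤ) ^ j • Pi.single (D.label j) 1 := fun j hj => by
    simp [label, Finset.mem_range.mp hj]
  have h2 : ∀ j ∈ Finset.range (m - i),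
      (-1 : ℤ) ^ (i + 2 + j) • (Pi.single ((D.cup i).label (i + 2 + j)) 1 : ℕ → ℤ)
      = (-1 : ℤ) ^ (i + j) • Pi.single (D.label (i + j)) 1 := fun j hj => by
    rw [label, if_neg (by omega), if_neg (by omega),
      show (i : ℕ) + 2 + j - 2 = i + j by omega]
    ring_nf
  rw [Finset.sum_congr rfl h1, Finset.sum_congr rfl h2]
  simp [label, pow_succ]

theorem alternatingSum_cap {m : ℕ} (D : LinkDiagram (m + 2)) (i : Fin (m + 1)) :
    (D.cap i).alternatingSum + (-1 : ℤ) ^ (i : ℕ) •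
      (Pi.single (D.label i) 1 - Pi.single (D.label (i + 1)) 1) = D.alternatingSum := by
  have hi : (i : ℕ) ≤ m := by omega
  rw [alternatingSum, alternatingSum, sum_range_add_two _ hi, sum_range_split _ hi]
  have h1 : ∀ j ∈ Finset.range (i : ℕ), (-1 : ℤ) ^ j • (Pi.single ((D.cap i).label j) 1 : ℕ → ℤ)
      = (-1 : ℤ) ^ j • Pi.single (D.label j) 1 := fun j hj => by
    simp [label, Finset.mem_range.mp hj]
  have h2 : ∀ j ∈ Finset.range (m - i),
      (-1 : ℤ) ^ (i + j) • (Pi.single ((D.cap i).label (i + j)) 1 : ℕ → ℤ)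
      = (-1 : ℤ) ^ (i + 2 + j) • Pi.single (D.label (i + 2 + j)) 1 := fun j hj => by
    rw [label, if_neg (by omega), show (i : ℕ) + j + 2 = i + 2 + j by omega]
    ring_nf
  rw [Finset.sum_congr rfl h1, Finset.sum_congr rfl h2, pow_succ, smul_sub, mul_smul,
    neg_one_smul, smul_neg]
  abel

/-- With `a`, `b` below the crossing and new arc `c`, the difference `a - b` becomes `c - a` or `b -
c`; the change is the crossing relation up to sign. -/
theorem alternatingSum_cross {m : ℕ} (D : LinkDiagram (m + 2)) (i : Fin (m + 1)) (s : Bool) :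
    (D.cross i s).alternatingSum + (-1 : ℤ) ^ ((i : ℕ) + if s then 0 else 1) •
      (Pi.single (D.label (if s then i else i + 1)) 2
        - Pi.single (D.label (if s then i + 1 else i)) 1 - Pi.single D.arcs 1)
      = D.alternatingSum := by
  have hi : (i : ℕ) ≤ m := by omega
  rw [alternatingSum, alternatingSum, sum_range_add_two _ hi, sum_range_add_two _ hi]
  have h1 : ∀ j ∈ Finset.range (i : ℕ), (-1 : ℤ) ^ j • (Pi.single ((D.cross i s).label j) 1 : ℕ → ℤ)
      = (-1 : ℤ) ^ j • Pi.single (D.label j) 1 := fun j hj => by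
    have := Finset.mem_range.mp hj
    rw [label, if_neg (by omega), if_neg (by omega)]
  have h2 : ∀ j ∈ Finset.range (m - i),
      (-1 : ℤ) ^ (i + 2 + j) • (Pi.single ((D.cross i s).label (i + 2 + j)) 1 : ℕ → ℤ)
      = (-1 : ℤ) ^ (i + 2 + j) • Pi.single (D.label (i + 2 + j)) 1 := fun j hj => by
    rw [label, if_neg (by omega), if_neg (by omega)]
  have h3 : ∀ p : ℕ, (Pi.single p 2 : ℕ → ℤ) = Pi.single p 1 + Pi.single p 1 := fun p => by
    rw [← Pi.single_add]; rfl
  rw [Finset.sum_congr rfl h1, Finset.sum_congr rfl h2, h3]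
  cases s <;> simp only [label, pow_succ, smul_sub, smul_add,
    if_true, if_false, Bool.false_eq_true, Nat.succ_ne_self, add_zero, mul_neg, mul_one,
    neg_smul] <;> abel

theorem exists_sum_smul_cons {A : Type*} [AddCommGroup A] {L : List A} {r v w : A} (u : ℤˣ)
    (hL : ∃ ε : Fin L.length → ℤˣ, ∑ i, (ε i : ℤ) • L.get i = w) (hv : v + (u : ℤ) • r = w) :
    ∃ ε : Fin (r :: L).length → ℤˣ, ∑ i, (ε i : ℤ) • (r :: L).get i = v := by
  obtain ⟨ε, hε⟩ := hL
  refine ⟨(Fin.cons (-u) ε : Fin (L.length + 1) → ℤˣ), ?_⟩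
  refine (Fin.sum_univ_succ (n := L.length) _).trans ?_
  simp only [Fin.cons_zero, Fin.cons_succ, List.get_cons_zero, List.get_cons_succ']
  rw [hε, ← hv]
  simp

/-- At `t = -1`, the relations satisfy a linear relation with coefficients `±1`. -/
theorem exists_sum_smul_relations (o : ℕ → Bool) : ∀ {m : ℕ} (D : LinkDiagram m),
    ∃ ε : Fin (D.relations (-1 : ℤ) o).length → ℤˣ,
      ∑ i, (ε i : ℤ) • (D.relations (-1 : ℤ) o).get i = D.alternatingSum
  | _, empty => ⟨fun _ => 1, Finset.sum_eq_zero fun i => i.elim0⟩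
  | _, cup D i => by
      rw [alternatingSum_cup]
      exact exists_sum_smul_relations o D
  | _, cap D i =>
      exists_sum_smul_cons ((-1) ^ (i : ℕ)) (exists_sum_smul_relations o D)
        (by simpa using D.alternatingSum_cap i)
  | _, cross D i s => by
      rw [relations_neg_one_cross]
      exact exists_sum_smul_cons ((-1) ^ ((i : ℕ) + if s then 0 else 1))
        (exists_sum_smul_relations o D) (by simpa using D.alternatingSum_cross i s)

/-! ### Colorings and the Gaussian bracket -/

/-- The coloring of the arcs in which the left leg of the minimum with arc number `k` has the color
`x k`, and which satisfies the relations of the crossings at `t = -1`. -/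
def coloring (x : ℕ → ℤ) : {m : ℕ} → LinkDiagram m → ℕ → ℤ
  | _, empty => x
  | _, cup D _ => D.coloring x
  | _, cap D _ => D.coloring x
  | _, cross D i s => Function.update (D.coloring x) D.arcs
      (2 * D.coloring x (D.label (if s then i else i + 1))
        - D.coloring x (D.label (if s then i + 1 else i)))

/-- The color of the strand in position `j` on the top line. -/
def color (x : ℕ → ℤ) {m : ℕ} (D : LinkDiagram m) (j : ℕ) : ℤ := D.coloring x (D.label j)

theorem color_cross (x : ℕ → ℤ) {m : ℕ} (D : LinkDiagram (m + 2)) (i : Fin (m + 1)) (s : Bool)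
    {j : ℕ} (hj : j < m + 2) : (D.cross i s).color x j =
      if j = i then (if s then 2 * D.color x i - D.color x (i + 1) else D.color x (i + 1))
      else if j = i + 1 then (if s then D.color x i else 2 * D.color x (i + 1) - D.color x i)
      else D.color x j := by
  have := (D.label_lt_arcs hj).ne
  have := (D.label_lt_arcs (j := i) (by omega)).ne
  have := (D.label_lt_arcs (j := i + 1) (by omega)).ne
  simp only [color, label, coloring]
  split_ifs <;> simp [*]

/-- A crossing turns colors `(c, d)` into `(2c - d, c)` or `(d, 2d - c)`: both positions are
translated by the same `±(c - d)`, so the difference persists and the translations add up. -/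
theorem color_twist (x : ℕ → ℤ) {m : ℕ} (D : LinkDiagram (m + 2)) (i : Fin (m + 1)) (s : Bool)
    (k : ℕ) {j : ℕ} (hj : j < m + 2) : (D.twist i s k).color x j = D.color x j +
      if j = i ∨ j = i + 1 then
        k * (if s then D.color x i - D.color x (i + 1) else D.color x (i + 1) - D.color x i)
      else 0 := by
  induction k generalizing j with
  | zero => simp [twist]
  | succ k ih =>
    rw [twist, color_cross x _ i s hj, ih (by omega), ih (by omega), ih hj]
    rcases eq_or_ne j i with rfl | h1
    · cases s <;> simp <;> ring
    rcases eq_or_ne j (i + 1) with rfl | h2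
    · cases s <;> simp <;> ring
    · simp [h1, h2]

/-- The bracket without the last argument. -/
def initialBracket : (n : ℕ) → (Fin n → ℕ) → ℕ
  | 0, _ => 0
  | n + 1, a => gaussianBracket n fun i => a i.castSucc

/-- The value `0` of `initialBracket` at `n = 0` makes the recursion valid from the first conway on.
-/
theorem gaussianBracket_succ (n : ℕ) (a : Fin (n + 1) → ℕ) :
    gaussianBracket (n + 1) a = a (Fin.last n) * gaussianBracket n (fun i => a i.castSucc)
      + initialBracket n fun i => a i.castSucc := by
  cases n with
  | zero => simp [gaussianBracket, initialBracket]
  | succ n => rfl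

/-- The strands twisted next differ by the current bracket up to sign, so the other difference grows
by the conway times that bracket. The alternating handedness makes the contributions add rather than
cancel. -/
theorem color_rationalTangle (n : ℕ) (a : Fin n → ℕ) :
    let T := (rationalTangle n a).color Nat.cast
    T 0 - T 1 = (if Even n then initialBracket n a else gaussianBracket n a : ℕ) ∧
    T 1 - T 2 = -(if Even n then gaussianBracket n a else initialBracket n a : ℕ) := by
  induction n with
  | zero => simp [rationalTangle, color, label, coloring, arcs, initialBracket, gaussianBracket]
  | succ n ih =>
    have h := ih fun i => a i.castSucc
    simp only at h
    simp only [rationalTangle]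
    rw [color_twist _ _ _ _ _ (by omega), color_twist _ _ _ _ _ (by omega),
      color_twist _ _ _ _ _ (by omega), gaussianBracket_succ]
    by_cases hn : Even n
    · simp only [hn, if_true, Nat.even_add_one, not_true, if_false, initialBracket] at h ⊢
      obtain ⟨h1, h2⟩ := h
      simp
      exact ⟨by linear_combination h1 - (a (Fin.last n) : ℤ) * h2, h2⟩
    · simp only [hn, if_true, Nat.even_add_one, not_false_iff, if_false, initialBracket] at h ⊢
      obtain ⟨h1, h2⟩ := h
      simp
      exact ⟨h1, by linear_combination h2 - (a (Fin.last n) : ℤ) * h1⟩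

/-! ### Braids on two minima: triangularity and orientations -/

/-- Four strands that start from two minima side by side and cross each other. -/
inductive IsTwoCupBraid : LinkDiagram 4 → Prop
  | base : IsTwoCupBraid (cup (m := 2) (cup (m := 0) empty 0) 2)
  | cross {D : LinkDiagram 4} (i : Fin 3) (s : Bool) : IsTwoCupBraid D →
      IsTwoCupBraid (cross (m := 2) D i s)

theorem IsTwoCupBraid.twist {D : LinkDiagram 4} (hD : D.IsTwoCupBraid) (i : Fin 3) (s : Bool)
    (k : ℕ) : IsTwoCupBraid (twist (m := 2) D i s k) := by
  induction k with
  | zero => exact hD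
  | succ k ih => exact ih.cross i s

theorem isTwoCupBraid_rationalTangle : ∀ (n : ℕ) (a : Fin n → ℕ),
    IsTwoCupBraid (rationalTangle n a)
  | 0, _ => .base
  | n + 1, _ => (isTwoCupBraid_rationalTangle n _).twist _ _ _

namespace IsTwoCupBraid

/-- The excess `2` comes from the minima; the relations of the two closing maxima will make the
matrix square. -/
theorem arcs_eq {R : Type*} [CommRing R] (t : R) (o : ℕ → Bool) {D : LinkDiagram 4}
    (hD : D.IsTwoCupBraid) : D.arcs = (D.relations t o).length + 2 := by
  induction hD with
  | base => rfl
  | cross i s _ ih => simp [arcs, relations, ih]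

theorem coloring_apply_of_lt_two (x : ℕ → ℤ) {D : LinkDiagram 4} (hD : D.IsTwoCupBraid) {j : ℕ}
    (hj : j < 2) : D.coloring x j = x j := by
  induction hD with
  | base => rfl
  | cross i s hD ih =>
    have := hD.arcs_eq (1 : ℤ) fun _ => true
    rw [coloring, Function.update_of_ne (by omega), ih]

/-- The color of each new arc is defined by solving its crossing relation, and earlier relations do
not involve that arc. -/
theorem sum_relation_mul_coloring (o : ℕ → Bool) (x : ℕ → ℤ) {D : LinkDiagram 4}
    (hD : D.IsTwoCupBraid) :
    ∀ r ∈ D.relations (-1 : ℤ) o, ∑ j ∈ Finset.range D.arcs, r j * D.coloring x j = 0 := by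
  induction hD with
  | base => simp [relations]
  | @cross D i s _ ih =>
    intro r hr
    rw [relations_neg_one_cross, List.mem_cons] at hr
    have h1 := D.label_lt_arcs (j := i) (by omega)
    have h2 := D.label_lt_arcs (j := i + 1) (by omega)
    rw [arcs]
    rcases hr with rfl | hr
    · simp only [Pi.sub_apply, sub_mul, Finset.sum_sub_distrib]
      rw [sum_single_mul (by split_ifs <;> omega), sum_single_mul (by split_ifs <;> omega),
        sum_single_mul (by omega), coloring, Function.update_self,
        Function.update_of_ne (by split_ifs <;> omega),
        Function.update_of_ne (by split_ifs <;> omega)]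
      ring
    · rw [Finset.sum_range_succ, relations_apply_eq_zero o D r hr _ le_rfl, zero_mul, add_zero,
        ← ih r hr]
      refine Finset.sum_congr rfl fun j hj => ?_
      rw [coloring, Function.update_of_ne (Finset.mem_range.mp hj).ne]

/-- Relations are listed newest first, so entry `k` belongs to the crossing that created arc `length
+ 1 - k`: this under-arc has coefficient `-1`, and later arcs do not occur. -/
theorem relations_diag (o : ℕ → Bool) {D : LinkDiagram 4} (hD : D.IsTwoCupBraid) :
    ∀ (k : ℕ) (hk : k < (D.relations (-1 : ℤ) o).length),
      (D.relations (-1 : ℤ) o)[k] ((D.relations (-1 : ℤ) o).length + 1 - k) = -1 ∧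
      ∀ j, (D.relations (-1 : ℤ) o).length + 1 - k < j → (D.relations (-1 : ℤ) o)[k] j = 0 := by
  induction hD with
  | base => intro k hk; simp [relations] at hk
  | @cross D i s hD ih =>
    have h1 := D.label_lt_arcs (j := i) (by omega)
    have h2 := D.label_lt_arcs (j := i + 1) (by omega)
    have h3 := hD.arcs_eq (-1 : ℤ) o
    rw [relations_neg_one_cross]
    intro k hk
    rw [List.length_cons] at hk ⊢
    cases k with
    | zero =>
      simp only [List.getElem_cons_zero, Pi.sub_apply, Pi.single_apply]
      constructor
      · rw [if_neg (by split_ifs <;> omega), if_neg (by split_ifs <;> omega), if_pos (by omega)]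
        norm_num
      · intro j hj
        rw [if_neg (by split_ifs <;> omega), if_neg (by split_ifs <;> omega), if_neg (by omega)]
        norm_num
    | succ k =>
      simp only [List.getElem_cons_succ, Nat.add_sub_add_right]
      exact ih k (by omega)

/-- The strands on the top line are directed like those above the two minima in some order. -/
theorem exists_perm_up {D : LinkDiagram 4} (hD : D.IsTwoCupBraid) :
    ∃ σ : Equiv.Perm (Fin 4), ∀ (o : ℕ → Bool) (j : Fin 4),
      D.up o j = ![o 0, !o 0, o 1, !o 1] (σ j) := by
  induction hD with
  | base => exact ⟨1, fun o j => by fin_cases j <;> simp [up, arcs]⟩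
  | @cross D i s _ ih =>
    obtain ⟨σ, hσ⟩ := ih
    refine ⟨(Equiv.swap i.castSucc i.succ).trans σ, fun o j => ?_⟩
    simp only [Equiv.trans_apply]
    rw [← hσ, up]
    rcases eq_or_ne j i.castSucc with rfl | h1
    · simp
    rcases eq_or_ne j i.succ with rfl | h2
    · simp
    · rw [Equiv.swap_apply_of_ne_of_ne h1 h2, if_neg, if_neg]
      · simpa [Fin.ext_iff] using h2
      · simpa [Fin.ext_iff] using h1

theorem isOrientation (o : ℕ → Bool) {D : LinkDiagram 4} (hD : D.IsTwoCupBraid) :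
    D.IsOrientation o := by
  induction hD with
  | base => trivial
  | cross i s _ ih => exact ih

theorem exists_isOrientation {D : LinkDiagram 4} (hD : D.IsTwoCupBraid) (i : Fin 3) :
    ∃ o : ℕ → Bool, (cap (m := 0) (cap (m := 2) D i) 0).IsOrientation o := by
  obtain ⟨σ, hσ⟩ := hD.exists_perm_up
  -- The second pair is what remains for the outer maximum: strands `2, 3`, `0, 3` or `0, 1` for `i
  -- = 0, 1, 2`.
  have key : ∀ (i : Fin 3) (σ : Equiv.Perm (Fin 4)), ∃ b c : Bool,
      (![b, !b, c, !c] (σ i.castSucc) ≠ ![b, !b, c, !c] (σ i.succ)) ∧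
      (![b, !b, c, !c] (σ (if i = 0 then 2 else 0)) ≠ ![b, !b, c, !c] (σ (if i = 2 then 1 else 3)))
    := by decide
  obtain ⟨b, c, h1, h2⟩ := key i σ
  refine ⟨fun k => if k = 0 then b else c, ⟨hD.isOrientation _, ?_⟩, ?_⟩
  · have e1 := hσ (fun k => if k = 0 then b else c) i.castSucc
    have e2 := hσ (fun k => if k = 0 then b else c) i.succ
    simp only [Fin.val_castSucc, Fin.val_succ] at e1 e2
    rw [e1, e2]
    simpa using h1
  · have e := fun j => hσ (fun k => if k = 0 then b else c) j
    have e0 := e 0; have e1 := e 1; have e2 := e 2; have e3 := e 3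
    simp only [up]
    fin_cases i <;> simp_all

end IsTwoCupBraid

/-! ### Evaluation of the minors and conclusion -/

theorem relations_map {R S : Type*} [CommRing R] [CommRing S] (φ : R →+* S) (t : R) (o : ℕ → Bool) :
    ∀ {m : ℕ} (D : LinkDiagram m),
      D.relations (φ t) o = (D.relations t o).map fun r j => φ (r j)
  | _, empty => rfl
  | _, cup D i => relations_map φ t o D
  | _, cap D i => by
      rw [relations, relations, List.map_cons, relations_map φ t o D]
      congr 1
      ext j
      simp only [Pi.sub_apply, Pi.single_apply, map_sub]
      split_ifs <;> simp
  | _, cross D i s => by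
      rw [relations, relations, List.map_cons, relations_map φ t o D]
      congr 1
      ext j
      simp only [Pi.sub_apply, Pi.add_apply, Pi.single_apply, map_sub, map_add]
      congr 1 <;> [congr 1; skip] <;> split_ifs <;> simp

/-- Up to sign, the minors of maximal proper order of the Alexander matrix at `t = -1` are the color
difference of the strands that are joined by the first maximum. -/
theorem IsTwoCupBraid.abs_det_alexanderMatrix {D : LinkDiagram 4} (hD : D.IsTwoCupBraid)
    (i : Fin 3) (o : ℕ → Bool) {k : ℕ}
    (hk : k + 1 = (cap (m := 0) (cap (m := 2) D i) 0).arcs) :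
    ∀ (f : Fin k → Fin ((cap (m := 0) (cap (m := 2) D i) 0).relations (-1 : ℤ) o).length)
      (g : Fin k → Fin (cap (m := 0) (cap (m := 2) D i) 0).arcs),
      Function.Injective f → Function.Injective g →
    |(((cap (m := 0) (cap (m := 2) D i) 0).alexanderMatrix (-1 : ℤ) o).submatrix f g).det| =
      |D.color Nat.cast i - D.color Nat.cast (i + 1)| := by
  set E := cap (m := 0) (cap (m := 2) D i) 0
  have hA := hD.arcs_eq (-1 : ℤ) o
  have hEA : E.arcs = (D.relations (-1 : ℤ) o).length + 2 := hA
  obtain rfl : k = (D.relations (-1 : ℤ) o).length + 1 := by omega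
  set c := (D.relations (-1 : ℤ) o).length
  intro f g hf hg
  let w : ℕ → ℤ := Pi.single (D.label i) 1 - Pi.single (D.label (i + 1)) 1
  let M : Matrix (Fin (c + 2)) (Fin (c + 2)) ℤ :=
    Matrix.of fun a b => (E.relations (-1 : ℤ) o).get a b
  obtain ⟨ε, hε⟩ := exists_sum_smul_relations o E
  -- A closed diagram has no strands on top, so its alternating sum is zero.
  have hM := Matrix.abs_det_submatrix_eq_of_sum_eq_zero M ε
    (by
      ext b
      refine (Finset.sum_apply b Finset.univ _).trans ?_
      have := congrFun hε b
      rw [Finset.sum_apply] at this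
      exact this.trans (by simp [alternatingSum]))
    (fun a => by
      refine (Finset.sum_range fun j => (E.relations (-1 : ℤ) o).get a j).symm.trans ?_
      exact sum_relation_eq_zero o E hEA.le _ (List.get_mem _ _))
    (f := f) (g := Fin.cast hEA ∘ g) hf ((Fin.cast_injective hEA).comp hg)
  refine hM.trans ?_
  -- Row `0` of `M` is the outer maximum; row `0` of `B` is the first maximum, followed by the
  -- crossings.
  let B : Matrix (Fin (c + 1)) (Fin (c + 1)) ℤ := M.submatrix Fin.succ Fin.succ
  have hB0 : ∀ b, B 0 b = w (b + 1) := fun b => rfl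
  have hBs : ∀ (a : Fin c) (b : Fin (c + 1)), B a.succ b =
      (D.relations (-1 : ℤ) o)[(a : ℕ)] (b + 1) := fun a b => rfl
  -- Omitting column `0` costs nothing because arc `0` has color `0`; arc `1`, of color `1`, then
  -- supplies the leading entry of the vector.
  have hx : ∀ r : ℕ → ℤ, ∑ j : Fin (c + 1), r (j + 1) * D.coloring Nat.cast (j + 1)
      = ∑ j ∈ Finset.range D.arcs, r j * D.coloring Nat.cast j := fun r => by
    rw [hA, Finset.sum_range_succ', hD.coloring_apply_of_lt_two _ (by omega),
      Finset.sum_range fun j => r (j + 1) * D.coloring Nat.cast (j + 1)]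
    simp
  rw [Matrix.abs_det_of_mulVec_eq_zero B fun j => D.coloring Nat.cast (j + 1)]
  · simp only [hB0]
    rw [hx w]
    simp only [w, Pi.sub_apply, sub_mul, Finset.sum_sub_distrib]
    rw [sum_single_mul (D.label_lt_arcs (by omega)), sum_single_mul (D.label_lt_arcs (by omega)),
      one_mul, one_mul]
    rfl
  · simpa using hD.coloring_apply_of_lt_two Nat.cast (j := 1) (by omega)
  · intro a
    simp only [hBs]
    rw [hx]
    exact hD.sum_relation_mul_coloring o _ _ (List.getElem_mem _)
  · intro a
    rw [hBs]
    have := (hD.relations_diag o a.rev (by omega)).1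
    rwa [show (D.relations (-1 : ℤ) o).length + 1 - (a.rev : ℕ) = a.succ + 1 by
      simp only [Fin.val_rev, Fin.val_succ]; omega] at this
  · intro a b hab
    rw [hBs]
    refine (hD.relations_diag o a.rev (by omega)).2 _ ?_
    simp only [Fin.val_rev, Fin.val_succ]
    have : (a : ℕ) < b := hab
    omega

/-- Evaluation at `-1` is a ring homomorphism: it commutes with minors and sends associated elements
to associated integers, which agree up to sign. For existence, a minor itself serves as the
polynomial. -/
theorem isConwayNumber_of_abs_det {D : LinkDiagram 0} {c : ℕ}
    (hlen : ∀ o : ℕ → Bool,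
      D.arcs = (D.relations (LaurentPolynomial.T 1 : ℤ[T;T⁻¹]) o).length)
    (hpos : 0 < D.arcs) (ho : ∃ o, D.IsOrientation o)
    (h : ∀ (o : ℕ → Bool) (k : ℕ) (f : Fin k → Fin (D.relations (-1 : ℤ) o).length)
      (g : Fin k → Fin D.arcs), k + 1 = D.arcs → Function.Injective f → Function.Injective g →
      |((D.alexanderMatrix (-1 : ℤ) o).submatrix f g).det| = c) :
    D.IsConwayNumber c := by
  constructor
  · obtain ⟨o, ho⟩ := ho
    exact ⟨o, _, ho, D.arcs - 1, Fin.castLE (by rw [← hlen o]; omega), Fin.castLE (by omega),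
      by omega, Fin.castLE_injective _, Fin.castLE_injective _, Associated.refl _⟩
  · rintro o Δ - ⟨k, f, g, hk, hf, hg, hΔ⟩
    let φ : ℤ[T;T⁻¹] →+* ℤ := LaurentPolynomial.eval₂ (RingHom.id ℤ) (-1 : ℤˣ)
    have hφ : φ (LaurentPolynomial.T 1) = -1 := by simp [φ]
    have hrel := relations_map φ (LaurentPolynomial.T 1) o D
    rw [hφ] at hrel
    have hl : (D.relations (LaurentPolynomial.T 1 : ℤ[T;T⁻¹]) o).length
        = (D.relations (-1 : ℤ) o).length := by rw [hrel, List.length_map]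
    have hdet : φ ((D.alexanderMatrix (LaurentPolynomial.T 1 : ℤ[T;T⁻¹]) o).submatrix f g).det
        = ((D.alexanderMatrix (-1 : ℤ) o).submatrix (Fin.cast hl ∘ f) g).det := by
      rw [RingHom.map_det]
      congr 1
      ext a b
      simp [alexanderMatrix, List.getElem_of_eq hrel]
    have hassoc := hΔ.map φ
    rw [hdet, Int.associated_iff_natAbs] at hassoc
    have := h o k (Fin.cast hl ∘ f) g hk ((Fin.cast_injective hl).comp hf) hg
    rw [Int.abs_eq_natAbs] at this
    exact hassoc.trans (by exact_mod_cast this)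

theorem isConwayNumber_rational (n : ℕ) (a : Fin n → ℕ) :
    (rational n a).IsConwayNumber (gaussianBracket n a) := by
  have hT := isTwoCupBraid_rationalTangle n a
  have harcs : ∀ o : ℕ → Bool, (rational n a).arcs
      = ((rational n a).relations (LaurentPolynomial.T 1 : ℤ[T;T⁻¹]) o).length := fun o =>
    hT.arcs_eq _ o
  refine isConwayNumber_of_abs_det harcs ?_ (hT.exists_isOrientation _) ?_
  · rw [harcs fun _ => true]
    exact Nat.succ_pos _
  · intro o k f g hk hf hg
    refine (hT.abs_det_alexanderMatrix _ o hk f g hf hg).trans ?_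
    obtain ⟨h1, h2⟩ := color_rationalTangle n a
    by_cases hn : Even n
    · simp only [hn, if_true] at h2 ⊢
      exact (congrArg abs h2).trans (by simp)
    · simp only [hn, if_false] at h1 ⊢
      exact (congrArg abs h1).trans (by simp)

end LinkDiagram

theorem theorem1 (n : ℕ) (hn : 2 ≤ n) (hn' : n ≤ 5) :
    LinkDiagram.IsConwayFunction (LinkDiagram.rational n) (gaussianBracket n) :=
  fun a => LinkDiagram.isConwayNumber_rational n a
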